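/- A rooted plane tree $t$ consists of a root and an ordered (possibly empty) finite sequence of branches, which are again rooted plane trees; a leaf is a vertex without children (so the root of the one-vertex tree is a leaf). For an integer $k\ge 0$, $t$ is called $k$-protected if the distance of its root to every leaf is at least $k$. For $n\ge 1$, let $r_{nk}$ be the number of $k$-protected rooted plane trees with $n$ vertices, and let $X_n$ be the protection number, i.e. the minimal distance of the root to a leaf, of a uniformly chosen random rooted plane tree with $n$ vertices; thus $\mathbb{P}(X_n\ge k)$ is the probability that a random rooted plane tree with $n$ vertices is $k$-protected. Then $$\mathbb{P}(X_n\ge k)=\frac{9\cdot 4^k}{(4^k+2)^2}+\frac{9\cdot 4^k\bigl((3k-8)4^{2k}+28\cdot 4^k-(12k+20)\bigr)}{2(4^k+2)^4}\cdot\frac1n+O\Bigl(\frac{k^2}{3^k n^{3/2}}\Bigr),$$ where the implied constant is absolute, i.e. the estimate is uniform in all integers $n\ge 1$ and $k\ge 0$. Moreover, for every complex $z$ with $0<|z|<\tfrac14$, put $R_0(z)=\frac{1-\sqrt{1-4z}}{2}$ with the principal square root. Then the generating functions $R_{\ge k}(z)=\sum_{n\ge 1} r_{nk}z^n$ converge,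 $R_{\ge 0}(z)=R_0(z)$, and for every $k\ge 1$ one has $1+z^{k-2}R_0(z)^3\neq 0$ and $$R_{\ge k}(z)=\frac{(1-z)z^{k-2}R_0(z)^3}{1+z^{k-2}R_0(z)^3}.$$ -/

import Mathlib

/-- Rooted plane trees: a root together with the ordered list of its branches. -/
inductive PlaneTree : Type
  | node : List PlaneTree → PlaneTree

namespace PlaneTree

/-- The number of vertices of a plane tree. -/
def numVertices : PlaneTree → ℕ
  | node ts => 1 + (ts.map numVertices).sum

/-- `t.HasLeafAtDepth d` : some leaf (vertex without children) of `t` is at distance `d` from the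
root of `t`. A tree with a single vertex is itself a leaf. -/
inductive HasLeafAtDepth : PlaneTree → ℕ → Prop
  | leaf : HasLeafAtDepth (node []) 0
  | branch {ts : List PlaneTree} {t : PlaneTree} {d : ℕ} (ht : t ∈ ts)
      (hd : HasLeafAtDepth t d) : HasLeafAtDepth (node ts) (d + 1)

/-- The protection number of a tree: the minimal distance of the root to a leaf. -/
noncomputable def protectionNumber (t : PlaneTree) : ℕ :=
  sInf {d : ℕ | t.HasLeafAtDepth d}

/-- The minimum defining the protection number is over a nonempty set. -/
theorem exists_hasLeafAtDepth : ∀ t : PlaneTree, ∃ d : ℕ, t.HasLeafAtDepth d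
  | node [] => ⟨0, .leaf⟩
  | node (t :: _) =>
    let ⟨d, hd⟩ := exists_hasLeafAtDepth t
    ⟨d + 1, .branch List.mem_cons_self hd⟩

/-- A tree is `k`-protected if the distance of its root to every leaf is at least `k`. -/
def IsProtected (k : ℕ) (t : PlaneTree) : Prop :=
  ∀ d : ℕ, t.HasLeafAtDepth d → k ≤ d

/-- A tree is `k`-protected if and only if its protection number is at least `k`. -/
theorem isProtected_iff (k : ℕ) (t : PlaneTree) : t.IsProtected k ↔ k ≤ t.protectionNumber :=
  ⟨fun h => h _ (Nat.sInf_mem t.exists_hasLeafAtDepth), fun h _ hd => h.trans (Nat.sInf_le hd)⟩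

/-- The set of plane trees with `n` vertices. -/
def ofSize (n : ℕ) : Set PlaneTree := {t | t.numVertices = n}

/-- There are finitely many plane trees with at most `n` vertices. -/
theorem finite_numVertices_le (n : ℕ) : {t : PlaneTree | t.numVertices ≤ n}.Finite := by
  induction n with
  | zero =>
    refine Set.Finite.subset Set.finite_empty ?_
    rintro ⟨ts⟩ h
    simp [numVertices] at h
  | succ n ih =>
    have : Finite {t : PlaneTree | t.numVertices ≤ n} := ih
    refine ((List.finite_length_le {t : PlaneTree | t.numVertices ≤ n} n).image
      fun l => node (l.map Subtype.val)).subset ?_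
    rintro ⟨ts⟩ h
    have h' : (ts.map numVertices).sum ≤ n := by
      simp only [Set.mem_ofPred_eq, numVertices] at h
      omega
    have hmem : ∀ t ∈ ts, t.numVertices ≤ n := fun t ht =>
      (List.single_le_sum (by simp) _ (List.mem_map_of_mem ht)).trans h'
    have hlen : ts.length ≤ (ts.map numVertices).sum := by
      have := List.length_le_sum_of_one_le (ts.map numVertices) (by
        intro i hi
        obtain ⟨⟨us⟩, -, rfl⟩ := List.mem_map.1 hi
        simp [numVertices])
      simpa using this
    refine ⟨ts.attach.map fun t => ⟨t.1, hmem t.1 t.2⟩, ?_, ?_⟩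
    · simpa using hlen.trans h'
    · simp [Function.comp_def]

/-- There are finitely many plane trees with `n` vertices. -/
theorem finite_ofSize (n : ℕ) : (ofSize n).Finite :=
  (finite_numVertices_le n).subset fun _ h => le_of_eq h

/-- The discrete `σ`-algebra on the countable set of plane trees. -/
instance : MeasurableSpace PlaneTree := ⊤

instance : DiscreteMeasurableSpace PlaneTree := ⟨fun _ => trivial⟩

/-- The number of `k`-protected plane trees with `n` vertices. -/
noncomputable def numProtected (n k : ℕ) : ℕ := {t ∈ ofSize n | t.IsProtected k}.ncard

/-- The law of a uniformly chosen random plane tree with `n` vertices. -/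
noncomputable def uniformTree (n : ℕ) : MeasureTheory.Measure PlaneTree :=
  ProbabilityTheory.uniformOn (ofSize n)

/-- For `n ≥ 1` the law of a random plane tree with `n` vertices is a probability measure. -/
theorem isProbabilityMeasure_uniformTree {n : ℕ} (hn : 1 ≤ n) :
    MeasureTheory.IsProbabilityMeasure (uniformTree n) := by
  refine ProbabilityTheory.isProbabilityMeasure_uniformOn (finite_ofSize n)
    ⟨node (List.replicate (n - 1) (node [])), ?_⟩
  simp only [ofSize, Set.mem_ofPred_eq, numVertices, List.map_replicate, List.sum_replicate,
    List.map_nil, List.sum_nil, smul_eq_mul]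
  omega

end PlaneTree

/-! A tree that is not a single vertex splits uniquely into its first branch and the rest. For the
generating functions this gives R_0 = z + R_0^2 and R_{k+1} = R_k (z + R_{k+1})
(`protectedSeries_zero`, `protectedSeries_succ`). Hence R_1 = R_0^2, and with W = z^{k-2} R_0^3 an
induction yields (1 + W) R_k = (1 - z) W. Read analytically on 0 < |z| < 1/4, where |R_k| ≤ 1/2,
this is the closed form (`protectedGF_formula`).

For the asymptotics no singularity analysis is used. The same identity holds for formal series, so
R_{k+2} is the alternating sum of (1 - z) z^{(m+1)k} R_0^{3(m+1)}, and each coefficient involved is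
an explicit ballot number (`powCoeff_mul_factorial`). Let c_n be the number of trees with n
vertices. Elementary product estimates give [z^n] z^s R_0^{b+1} / c_n = (b+1) 4^{-s} 2^{-b} (1 -
b(b-1)/(4n) + 3s/(2n) + O((b+1+s)^4/n^2)), uniformly in all parameters (`powCoeff_asymptotics`). The
main terms sum in closed form (`hasSum_main_terms`). The errors sum to O((k+4)^4 4^{-k} n^{-2}),
which is stronger than required (`abs_sub_main_terms_le`). The cases k = 0 and k = 1 are checked
directly. -/

namespace PlaneTree

open PowerSeries

/-! ### Decomposition of a tree at its first branch. -/

/-- Attach a tree as a new first branch at the root. -/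
def cons (t : PlaneTree) : PlaneTree → PlaneTree
  | node ts => node (t :: ts)

theorem cons_injective2 : Function.Injective2 cons := by
  rintro t t' ⟨ts⟩ ⟨ts'⟩ h
  simp only [cons, node.injEq, List.cons.injEq] at h
  exact ⟨h.1, by rw [h.2]⟩

theorem numVertices_cons (t u : PlaneTree) :
    (cons t u).numVertices = t.numVertices + u.numVertices := by
  rcases u with ⟨us⟩
  simp only [cons, numVertices, List.map_cons, List.sum_cons]
  omega

theorem numVertices_pos (t : PlaneTree) : 0 < t.numVertices := by
  rcases t with ⟨ts⟩
  simp [numVertices]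

theorem node_nil_or_cons (t : PlaneTree) : t = node [] ∨ ∃ u v, t = cons u v := by
  rcases t with ⟨_ | ⟨u, us⟩⟩
  · exact Or.inl rfl
  · exact Or.inr ⟨u, node us, rfl⟩

theorem cons_ne_node_nil (t u : PlaneTree) : cons t u ≠ node [] := by
  rcases u with ⟨us⟩
  simp [cons]

theorem isProtected_zero (t : PlaneTree) : t.IsProtected 0 := fun _ _ => Nat.zero_le _

theorem isProtected_succ_node (k : ℕ) (ts : List PlaneTree) :
    (node ts).IsProtected (k + 1) ↔ ts ≠ [] ∧ ∀ t ∈ ts, t.IsProtected k := by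
  constructor
  · intro h
    refine ⟨?_, fun t ht d hd => Nat.le_of_succ_le_succ (h _ (.branch ht hd))⟩
    rintro rfl
    exact absurd (h 0 .leaf) (by simp)
  · rintro ⟨h0, h⟩ d hd
    cases hd with
    | leaf => exact absurd rfl h0
    | branch ht hd => exact Nat.succ_le_succ (h _ ht _ hd)

theorem not_isProtected_succ_node_nil (k : ℕ) : ¬ (node []).IsProtected (k + 1) := by
  simp [isProtected_succ_node]

/-- The exceptional case `u = node []` is a root whose only branch is `t`. It produces the summand
`X` in the recursion for `protectedSeries`. -/
theorem isProtected_succ_cons (k : ℕ) (t u : PlaneTree) :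
    (cons t u).IsProtected (k + 1) ↔
      t.IsProtected k ∧ (u = node [] ∨ u.IsProtected (k + 1)) := by
  rcases u with ⟨us⟩
  simp only [cons, isProtected_succ_node, List.mem_cons, forall_eq_or_imp, node.injEq, ne_eq,
    reduceCtorEq, not_false_eq_true, true_and]
  by_cases h : us = []
  · simp [h]
  · simp [h]

/-! ### Counting series and their functional equations. -/

/-- The counting series, by number of vertices, of a set of plane trees. -/
noncomputable def countSeries (A : Set PlaneTree) : ℕ⟦X⟧ :=
  PowerSeries.mk fun n => (ofSize n ∩ A).ncard

theorem finite_ofSize_inter (n : ℕ) (A : Set PlaneTree) : (ofSize n ∩ A).Finite :=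
  (finite_ofSize n).inter_of_left A

theorem countSeries_image2_cons (A B : Set PlaneTree) :
    countSeries (Set.image2 cons A B) = countSeries A * countSeries B := by
  classical
  ext n
  rw [coeff_mul]
  simp only [countSeries, coeff_mk]
  have key : ofSize n ∩ Set.image2 cons A B =
      ((Finset.HasAntidiagonal.antidiagonal n).biUnion fun p =>
        Finset.image₂ cons (finite_ofSize_inter p.1 A).toFinset
          (finite_ofSize_inter p.2 B).toFinset : Finset PlaneTree) := by
    ext t
    simp only [Set.mem_inter_iff, Finset.coe_biUnion, Set.mem_iUnion, Finset.coe_image₂,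
      Set.Finite.coe_toFinset, Set.mem_image2, Finset.mem_coe, Finset.HasAntidiagonal.mem_antidiagonal,
      exists_prop, Prod.exists]
    constructor
    · rintro ⟨hn, u, hu, v, hv, rfl⟩
      have hn' : (cons u v).numVertices = n := hn
      rw [numVertices_cons] at hn'
      exact ⟨_, _, hn', u, ⟨rfl, hu⟩, v, ⟨rfl, hv⟩, rfl⟩
    · rintro ⟨i, j, hij, u, ⟨hu, hu'⟩, v, ⟨hv, hv'⟩, rfl⟩
      refine ⟨?_, u, hu', v, hv', rfl⟩
      have h1 : u.numVertices = i := hu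
      have h2 : v.numVertices = j := hv
      show (cons u v).numVertices = n
      rw [numVertices_cons, h1, h2, hij]
  rw [key, Set.ncard_coe_finset, Finset.card_biUnion]
  · refine Finset.sum_congr rfl fun p _ => ?_
    rw [Finset.card_image₂ cons_injective2, Set.ncard_eq_toFinset_card _ (finite_ofSize_inter _ _),
      Set.ncard_eq_toFinset_card _ (finite_ofSize_inter _ _)]
  · intro p _ q _ hpq
    refine Finset.disjoint_left.2 ?_
    intro t ht ht'
    simp only [Finset.mem_image₂, Set.Finite.mem_toFinset] at ht ht'
    obtain ⟨u, ⟨hu, -⟩, v, ⟨hv, -⟩, rfl⟩ := ht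
    obtain ⟨u', ⟨hu', -⟩, v', ⟨hv', -⟩, h⟩ := ht'
    obtain ⟨rfl, rfl⟩ := cons_injective2 h
    have h1 : u'.numVertices = p.1 := hu
    have h2 : v'.numVertices = p.2 := hv
    have h3 : u'.numVertices = q.1 := hu'
    have h4 : v'.numVertices = q.2 := hv'
    exact hpq (Prod.ext (h1.symm.trans h3) (h2.symm.trans h4))

theorem countSeries_insert_node_nil {A : Set PlaneTree} (h : node [] ∉ A) :
    countSeries (insert (node []) A) = X + countSeries A := by
  ext n
  rw [map_add, coeff_X]
  simp only [countSeries, coeff_mk]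
  have h1 : (node []).numVertices = 1 := by simp [numVertices]
  split_ifs with hn
  · subst hn
    rw [Set.inter_insert_of_mem (show node [] ∈ ofSize 1 from h1),
      Set.ncard_insert_of_notMem (fun h' => h h'.2) (finite_ofSize_inter _ _), add_comm]
  · rw [Set.inter_insert_of_notMem, zero_add]
    intro h'
    exact hn ((show (node []).numVertices = n from h').symm.trans h1)

/-- The generating function of `k`-protected plane trees. -/
noncomputable def protectedSeries (k : ℕ) : ℕ⟦X⟧ := countSeries {t | t.IsProtected k}

theorem coeff_protectedSeries (n k : ℕ) : coeff n (protectedSeries k) = numProtected n k := by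
  simp only [protectedSeries, countSeries, coeff_mk]
  rfl

theorem protectedSeries_zero :
    protectedSeries 0 = X + protectedSeries 0 * protectedSeries 0 := by
  have h : {t : PlaneTree | t.IsProtected 0} = Set.univ :=
    Set.eq_univ_of_forall isProtected_zero
  rw [protectedSeries, h, ← countSeries_image2_cons, ← countSeries_insert_node_nil]
  · congr 1
    refine (Set.eq_univ_of_forall fun t => ?_).symm
    rcases node_nil_or_cons t with rfl | ⟨u, v, rfl⟩
    · exact Set.mem_insert _ _
    · exact Set.mem_insert_of_mem _ (Set.mem_image2_of_mem trivial trivial)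
  · rintro ⟨u, -, v, -, h⟩
    exact cons_ne_node_nil u v h

theorem protectedSeries_succ (k : ℕ) :
    protectedSeries (k + 1) = protectedSeries k * (X + protectedSeries (k + 1)) := by
  rw [protectedSeries, protectedSeries,
    ← countSeries_insert_node_nil (not_isProtected_succ_node_nil k), ← countSeries_image2_cons]
  congr 1
  ext t
  constructor
  · intro ht
    rcases node_nil_or_cons t with rfl | ⟨u, v, rfl⟩
    · exact absurd ht (not_isProtected_succ_node_nil k)
    · obtain ⟨hu, hv⟩ := (isProtected_succ_cons k u v).1 ht
      exact Set.mem_image2_of_mem hu hv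
  · rintro ⟨u, hu, v, hv, rfl⟩
    exact (isProtected_succ_cons k u v).2 ⟨hu, hv⟩

theorem numProtected_zero_left (k : ℕ) : numProtected 0 k = 0 := by
  rw [numProtected, Set.ncard_eq_zero ((finite_ofSize 0).sep _)]
  ext t
  simp only [Set.mem_sep_iff, Set.mem_empty_iff_false, iff_false, not_and]
  intro h
  exact absurd (show t.numVertices = 0 from h) (numVertices_pos t).ne'

theorem numProtected_le_zero (n k : ℕ) : numProtected n k ≤ numProtected n 0 :=
  Set.ncard_le_ncard (fun _ h => ⟨h.1, isProtected_zero _⟩) ((finite_ofSize n).sep _)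

theorem uniformTree_real_le_protectionNumber (n k : ℕ) :
    (uniformTree n).real {t | k ≤ t.protectionNumber} =
      (numProtected n k : ℝ) / numProtected n 0 := by
  have hc : ∀ A : Set PlaneTree, A.Finite → MeasureTheory.Measure.count.real A = A.ncard := by
    intro A hA
    rw [MeasureTheory.measureReal_def, MeasureTheory.Measure.count_apply_finite A hA,
      Set.ncard_eq_toFinset_card A hA, ENNReal.toReal_natCast]
  have h0 : {t ∈ ofSize n | t.IsProtected 0} = ofSize n :=
    Set.sep_eq_self_iff_mem_true.2 fun t _ => isProtected_zero t
  have hk : ofSize n ∩ {t | k ≤ t.protectionNumber} = {t ∈ ofSize n | t.IsProtected k} := by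
    ext t
    simp [isProtected_iff]
  rw [uniformTree, ProbabilityTheory.uniformOn, MeasureTheory.measureReal_def,
    ProbabilityTheory.cond_apply (MeasurableSet.of_discrete (s := ofSize n)), ENNReal.toReal_mul, ENNReal.toReal_inv,
    ← MeasureTheory.measureReal_def, ← MeasureTheory.measureReal_def,
    hc _ (finite_ofSize n), hk, hc _ ((finite_ofSize n).sep _), numProtected, numProtected, h0]
  ring

/-! ### Absolute convergence on the closed disc of radius 1/4. -/

theorem numProtected_zero_right (n : ℕ) :
    numProtected n 0 = (if n = 1 then 1 else 0) +
      ∑ p ∈ Finset.HasAntidiagonal.antidiagonal n, numProtected p.1 0 * numProtected p.2 0 := by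
  have h := congrArg (coeff n) protectedSeries_zero
  rw [map_add, coeff_X, coeff_mul] at h
  simpa only [coeff_protectedSeries] using h

/-- The functional equation at z = 1/4 bounds partial sums by S_{N+1} ≤ 1/4 + S_N^2, and 1/2 is the
fixed point of x ↦ 1/4 + x^2. -/
theorem sum_numProtected_zero_le (N : ℕ) :
    ∑ n ∈ Finset.range N, (numProtected n 0 : ℝ) * (1 / 4) ^ n ≤ 1 / 2 := by
  induction N with
  | zero => norm_num
  | succ N ih =>
    set f : ℕ → ℝ := fun n => (numProtected n 0 : ℝ) * (1 / 4) ^ n with hf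
    have hf0 : ∀ n, 0 ≤ f n := fun n => by positivity
    have hfz : f 0 = 0 := by simp [hf, numProtected_zero_left]
    have hrec : ∀ n, f n = (if n = 1 then 1 / 4 else 0) +
        ∑ p ∈ Finset.HasAntidiagonal.antidiagonal n, f p.1 * f p.2 := by
      intro n
      have h : (numProtected n 0 : ℝ) = _ := congrArg (Nat.cast (R := ℝ)) (numProtected_zero_right n)
      simp only [hf]
      rw [h]
      push_cast
      rw [add_mul, Finset.sum_mul]
      congr 1
      · split_ifs with h1
        · simp [h1]
        · simp
      · refine Finset.sum_congr rfl fun p hp => ?_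
        rw [← Finset.HasAntidiagonal.mem_antidiagonal.1 hp, pow_add]
        ring
    have hS : 0 ≤ ∑ n ∈ Finset.range N, f n := Finset.sum_nonneg fun n _ => hf0 n
    have h1 : ∑ n ∈ Finset.range (N + 1), (if n = 1 then (1 / 4 : ℝ) else 0) ≤ 1 / 4 := by
      rw [Finset.sum_ite_eq']
      split_ifs <;> norm_num
    have h2 : ∑ n ∈ Finset.range (N + 1),
        ∑ p ∈ Finset.HasAntidiagonal.antidiagonal n, f p.1 * f p.2 ≤
        (∑ n ∈ Finset.range N, f n) * ∑ n ∈ Finset.range N, f n := by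
      rw [Finset.sum_mul_sum, ← Finset.sum_product']
      refine le_trans (Finset.sum_le_sum fun n hn => ?_)
        (Finset.sum_fiberwise_le_sum_of_sum_fiber_nonneg (t := Finset.range (N + 1))
          (g := fun p : ℕ × ℕ => p.1 + p.2)
          fun _ _ => Finset.sum_nonneg fun p _ => mul_nonneg (hf0 p.1) (hf0 p.2))
      -- Pairs with an entry outside `range N` have sum at most `N`, so the other entry is 0 and the
      -- product vanishes because `f 0 = 0`. This is why `S_N`, not `S_{N+1}`, appears squared.
      refine le_of_eq (Finset.sum_subset_zero_on_sdiff ?_ ?_ fun _ _ => rfl).symm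
      · intro p hp
        exact Finset.HasAntidiagonal.mem_antidiagonal.2 (Finset.mem_filter.1 hp).2
      · intro p hp
        obtain ⟨hp1, hp2⟩ := Finset.mem_sdiff.1 hp
        have hp1 := Finset.HasAntidiagonal.mem_antidiagonal.1 hp1
        simp only [Finset.mem_filter, Finset.mem_product, Finset.mem_range, hp1, and_true,
          not_and_or] at hp2
        have hn := Finset.mem_range.1 hn
        have : p.1 = 0 ∨ p.2 = 0 := by omega
        rcases this with h | h <;> simp [h, hfz]
    rw [Finset.sum_congr rfl fun n _ => hrec n, Finset.sum_add_distrib]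
    nlinarith

theorem summable_norm_numProtected (k : ℕ) {z : ℂ} (hz : ‖z‖ ≤ 1 / 4) :
    Summable fun n => ‖(numProtected n k : ℂ) * z ^ n‖ := by
  have h : Summable fun n => (numProtected n 0 : ℝ) * (1 / 4) ^ n :=
    summable_of_sum_range_le (fun n => by positivity) sum_numProtected_zero_le
  refine h.of_nonneg_of_le (fun n => norm_nonneg _) fun n => ?_
  rw [norm_mul, norm_pow, Complex.norm_natCast]
  have : (numProtected n k : ℝ) ≤ numProtected n 0 := by exact_mod_cast numProtected_le_zero n k
  gcongr

theorem norm_tsum_numProtected_le (k : ℕ) {z : ℂ} (hz : ‖z‖ ≤ 1 / 4) :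
    ‖∑' n, (numProtected n k : ℂ) * z ^ n‖ ≤ 1 / 2 := by
  refine (norm_tsum_le_tsum_norm (summable_norm_numProtected k hz)).trans ?_
  refine Real.tsum_le_of_sum_range_le (fun n => norm_nonneg _) fun N => ?_
  refine le_trans (Finset.sum_le_sum fun n _ => ?_) (sum_numProtected_zero_le N)
  rw [norm_mul, norm_pow, Complex.norm_natCast]
  have : (numProtected n k : ℝ) ≤ numProtected n 0 := by exact_mod_cast numProtected_le_zero n k
  gcongr

/-- Evaluation of counting series is multiplicative where they converge absolutely. -/
theorem hasSum_coeff_mul {φ ψ : ℕ⟦X⟧} {z : ℂ} (hφ : Summable fun n => ‖((coeff n φ : ℕ) : ℂ) * z ^ n‖)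
    (hψ : Summable fun n => ‖((coeff n ψ : ℕ) : ℂ) * z ^ n‖) :
    HasSum (fun n => ((coeff n (φ * ψ) : ℕ) : ℂ) * z ^ n)
      ((∑' n, ((coeff n φ : ℕ) : ℂ) * z ^ n) * ∑' n, ((coeff n ψ : ℕ) : ℂ) * z ^ n) := by
  rw [tsum_mul_tsum_eq_tsum_sum_antidiagonal_of_summable_norm hφ hψ]
  have h := (summable_norm_sum_mul_antidiagonal_of_summable_norm hφ hψ).of_norm.hasSum
  refine (congrArg (HasSum · _) (funext fun n => ?_)).mpr h
  rw [coeff_mul, Nat.cast_sum, Finset.sum_mul]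
  refine Finset.sum_congr rfl fun p hp => ?_
  rw [← Finset.HasAntidiagonal.mem_antidiagonal.1 hp, pow_add]
  push_cast
  ring

theorem hasSum_coeff_X (z : ℂ) : HasSum (fun n => ((coeff n (X : ℕ⟦X⟧) : ℕ) : ℂ) * z ^ n) z := by
  have := hasSum_single (f := fun n => ((coeff n (X : ℕ⟦X⟧) : ℕ) : ℂ) * z ^ n) 1 (by
    intro n hn
    simp [coeff_X, hn])
  simpa using this

/-! ### Closed form of the generating functions. -/

/-- The sum of the generating function of `k`-protected trees. -/
noncomputable def protectedGF (k : ℕ) (z : ℂ) : ℂ := ∑' n, (numProtected n k : ℂ) * z ^ n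

theorem hasSum_protectedGF (k : ℕ) {z : ℂ} (hz : ‖z‖ ≤ 1 / 4) :
    HasSum (fun n => (numProtected n k : ℂ) * z ^ n) (protectedGF k z) :=
  (summable_norm_numProtected k hz).of_norm.hasSum

theorem protectedGF_zero {z : ℂ} (hz : ‖z‖ ≤ 1 / 4) :
    protectedGF 0 z = z + protectedGF 0 z * protectedGF 0 z := by
  have hs := summable_norm_numProtected 0 hz
  have hp := hasSum_protectedGF 0 hz
  simp only [← coeff_protectedSeries] at hs hp
  refine hp.unique ?_
  have h2 := (hasSum_coeff_X z).add (hasSum_coeff_mul hs hs)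
  rw [hp.tsum_eq] at h2
  convert h2 using 2 with n
  rw [← add_mul]
  conv_lhs => rw [protectedSeries_zero]
  rw [map_add, Nat.cast_add]

theorem protectedGF_succ (k : ℕ) {z : ℂ} (hz : ‖z‖ ≤ 1 / 4) :
    protectedGF (k + 1) z = protectedGF k z * (z + protectedGF (k + 1) z) := by
  have hs := summable_norm_numProtected k hz
  have hp := hasSum_protectedGF k hz
  have hs' := summable_norm_numProtected (k + 1) hz
  have hp' := hasSum_protectedGF (k + 1) hz
  simp only [← coeff_protectedSeries] at hs hp hs' hp'
  refine hp'.unique ?_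
  have hX : Summable fun n => ‖((coeff n (X : ℕ⟦X⟧) : ℕ) : ℂ) * z ^ n‖ :=
    (hasSum_coeff_X z).summable.norm
  have h2 := (hasSum_coeff_mul hs hX).add (hasSum_coeff_mul hs hs')
  rw [hp.tsum_eq, hp'.tsum_eq, (hasSum_coeff_X z).tsum_eq, ← mul_add] at h2
  convert h2 using 2 with n
  rw [← add_mul]
  conv_lhs => rw [protectedSeries_succ, mul_add]
  rw [map_add, Nat.cast_add]

/-- The quadratic equation leaves two candidates. The bound |R| ≤ 1/2 puts 1 - 2R in the right
half-plane, which selects the principal root. -/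
theorem protectedGF_zero_eq {z : ℂ} (hz : ‖z‖ < 1 / 4) :
    protectedGF 0 z = (1 - (1 - 4 * z) ^ (1 / 2 : ℂ)) / 2 := by
  set R := protectedGF 0 z with hR
  have h1 : R = z + R * R := protectedGF_zero hz.le
  have hn : ‖R‖ ≤ 1 / 2 := norm_tsum_numProtected_le 0 hz.le
  have hre : 0 ≤ (1 - 2 * R).re := by
    have := (Complex.re_le_norm R).trans hn
    simp
    linarith
  have hsq : (1 - 2 * R) ^ 2 = 1 - 4 * z := by linear_combination (-4) * h1
  have hpos : 0 < (1 - 2 * R).re := by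
    -- If 1 - 2R were purely imaginary, its square 1 - 4z would have nonpositive real part,
    -- contradicting |z| < 1/4.
    refine lt_of_le_of_ne hre fun h0 => ?_
    have h2 := congrArg Complex.re hsq
    have h3 := Complex.re_le_norm z
    rw [pow_two, Complex.mul_re, ← h0] at h2
    simp at h2
    nlinarith [sq_nonneg R.im]
  have h4 : (1 - 4 * z) ^ (1 / 2 : ℂ) = 1 - 2 * R := by
    rw [← hsq, one_div, Complex.sq_cpow_two_inv hpos]
  rw [h4]
  ring

/-- Both claims go through one induction: the formula for index k + 1 expresses 1 - R_{k+1} as the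
quotient of the next denominator by the current one. As |R_{k+1}| ≤ 1/2, the next denominator cannot
vanish. -/
theorem protectedGF_formula {z : ℂ} (hz0 : z ≠ 0) (hz : ‖z‖ < 1 / 4) (k : ℕ) :
    1 + z ^ (((k + 1 : ℕ) : ℤ) - 2) * protectedGF 0 z ^ 3 ≠ 0 ∧
      protectedGF (k + 1) z = (1 - z) * z ^ (((k + 1 : ℕ) : ℤ) - 2) * protectedGF 0 z ^ 3 /
        (1 + z ^ (((k + 1 : ℕ) : ℤ) - 2) * protectedGF 0 z ^ 3) := by
  have hne : ∀ k, 1 - protectedGF k z ≠ 0 := by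
    intro k h
    have h1 := norm_tsum_numProtected_le k hz.le
    rw [← protectedGF, ← sub_eq_zero.1 h] at h1
    norm_num at h1
  have hz1 : 1 - z ≠ 0 := by
    intro h
    rw [← sub_eq_zero.1 h] at hz
    norm_num at hz
  induction k with
  | zero =>
    set R := protectedGF 0 z with hR
    have h1 : R = z + R * R := protectedGF_zero hz.le
    have hR0 : R ≠ 0 := by
      intro h
      rw [h] at h1
      exact hz0 (by simpa using h1.symm)
    have he : z ^ (((0 + 1 : ℕ) : ℤ) - 2) = z⁻¹ := by norm_num
    have h2 : protectedGF 1 z = R * (z + protectedGF 1 z) := protectedGF_succ 0 hz.le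
    have h3 : protectedGF 1 z = R ^ 2 := by
      refine mul_left_cancel₀ (hne 0) ?_
      rw [← hR]
      linear_combination h2 - R * h1
    have h4 : 1 + z⁻¹ * R ^ 3 = R * (1 - z) / z := by
      field_simp
      linear_combination (-1 - R) * h1
    rw [he, h4, zero_add, h3]
    refine ⟨div_ne_zero (mul_ne_zero hR0 hz1) hz0, ?_⟩
    field_simp
  | succ k ih =>
    set R := protectedGF 0 z with hR
    have he : z ^ (((k + 1 + 1 : ℕ) : ℤ) - 2) = z * z ^ (((k + 1 : ℕ) : ℤ) - 2) := by
      rw [← zpow_one_add₀ hz0]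
      congr 1
      push_cast
      ring
    rw [he]
    set W := z ^ (((k + 1 : ℕ) : ℤ) - 2) with hW
    obtain ⟨ih1, ih2⟩ := ih
    have h2 := protectedGF_succ (k + 1) hz.le
    have h3 : 1 - protectedGF (k + 1) z = (1 + z * W * R ^ 3) / (1 + W * R ^ 3) := by
      rw [ih2]
      field_simp
      ring
    have h4 : 1 + z * W * R ^ 3 ≠ 0 := fun h => hne (k + 1) (by rw [h3, h, zero_div])
    refine ⟨h4, ?_⟩
    have h5 := hne (k + 1)
    rw [h3] at h5
    refine mul_left_cancel₀ h5 ?_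
    rw [← h3]
    have h7 : (1 - protectedGF (k + 1) z) * protectedGF (k + 1 + 1) z
      = z * protectedGF (k + 1) z := by linear_combination h2
    rw [h7, h3, ih2]
    field_simp

/-! ### Formal identity and geometric expansion. -/

/-- The generating function of `k`-protected plane trees with real coefficients. -/
noncomputable def realSeries (k : ℕ) : ℝ⟦X⟧ :=
  PowerSeries.map (Nat.castRingHom ℝ) (protectedSeries k)

theorem coeff_realSeries (n k : ℕ) : coeff n (realSeries k) = (numProtected n k : ℝ) := by
  rw [realSeries, coeff_map, coeff_protectedSeries]
  rfl

theorem realSeries_zero : realSeries 0 = X + realSeries 0 * realSeries 0 := by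
  have h := congrArg (PowerSeries.map (Nat.castRingHom ℝ)) protectedSeries_zero
  rwa [map_add, map_X, map_mul] at h

theorem realSeries_succ (k : ℕ) :
    realSeries (k + 1) = realSeries k * (X + realSeries (k + 1)) := by
  have h := congrArg (PowerSeries.map (Nat.castRingHom ℝ)) (protectedSeries_succ k)
  rwa [map_mul, map_add, map_X] at h

theorem X_dvd_realSeries (k : ℕ) : (X : ℝ⟦X⟧) ∣ realSeries k := by
  rw [X_dvd_iff, ← coeff_zero_eq_constantCoeff_apply, coeff_realSeries, numProtected_zero_left]
  simp

theorem one_sub_realSeries_ne_zero (k : ℕ) : 1 - realSeries k ≠ 0 := by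
  intro h
  have h1 := congrArg (coeff 0) h
  rw [map_sub, coeff_realSeries, numProtected_zero_left] at h1
  simp at h1

theorem realSeries_one : realSeries 1 = realSeries 0 ^ 2 := by
  refine mul_left_cancel₀ (one_sub_realSeries_ne_zero 0) ?_
  linear_combination realSeries_succ 0 - realSeries 0 * realSeries_zero

/-- Starting at index k + 2 keeps the exponent of `X` nonnegative, so the closed form makes sense
for power series. -/
theorem one_add_mul_realSeries (k : ℕ) :
    (1 + X ^ k * realSeries 0 ^ 3) * realSeries (k + 2) =
      (1 - X) * (X ^ k * realSeries 0 ^ 3) := by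
  induction k with
  | zero =>
    have h0 := realSeries_zero
    have h3 := realSeries_one
    have h2 := realSeries_succ 1
    have hne := one_sub_realSeries_ne_zero 0
    set R := realSeries 0
    simp only [zero_add] at h2 ⊢
    norm_num at h2
    rw [h3] at h2
    refine mul_left_cancel₀ hne ?_
    linear_combination (1 - R + R ^ 2) * h2 - ((1 - R + R ^ 2) * R ^ 2 + R ^ 3 * (1 - R)) * h0
  | succ k ih =>
    have h := realSeries_succ (k + 2)
    set R := realSeries 0
    rw [pow_succ]
    linear_combination (1 + X ^ k * R ^ 3) * h + (X + realSeries (k + 2 + 1)) * ih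

theorem realSeries_eq_sum (k M : ℕ) :
    realSeries (k + 2) =
      ∑ m ∈ Finset.range M, (-1) ^ m * ((1 - X) * (X ^ k * realSeries 0 ^ 3) ^ (m + 1)) +
        (-1) ^ M * (X ^ k * realSeries 0 ^ 3) ^ M * realSeries (k + 2) := by
  induction M with
  | zero => simp
  | succ M ih =>
    rw [Finset.sum_range_succ]
    have h := one_add_mul_realSeries k
    set W := X ^ k * realSeries 0 ^ 3
    rw [pow_succ W M, pow_succ (-1) M]
    linear_combination ih + (-1) ^ M * W ^ M * h

/-- The coefficients of `z ^ s * R ^ b`, where `R` is the generating function of plane trees. -/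
noncomputable def powCoeff (n s b : ℕ) : ℝ := coeff n (X ^ s * realSeries 0 ^ b)

theorem powCoeff_eq_zero {n s b : ℕ} (h : n < s + b) : powCoeff n s b = 0 := by
  have hd : (X : ℝ⟦X⟧) ^ (s + b) ∣ X ^ s * realSeries 0 ^ b := by
    rw [pow_add]
    exact mul_dvd_mul_left _ (pow_dvd_pow_of_dvd (X_dvd_realSeries 0) b)
  exact X_pow_dvd_iff.1 hd n h

theorem powCoeff_add (n s b : ℕ) : powCoeff (n + s) s b = powCoeff n 0 b := by
  rw [powCoeff, powCoeff, coeff_X_pow_mul, pow_zero, one_mul]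

theorem hasSum_numProtected (n k : ℕ) :
    HasSum (fun m : ℕ => (-1 : ℝ) ^ m *
        (powCoeff n ((m + 1) * k) (3 * (m + 1)) - powCoeff n ((m + 1) * k + 1) (3 * (m + 1))))
      (numProtected n (k + 2)) := by
  have h : (numProtected n (k + 2) : ℝ) = ∑ m ∈ Finset.range (n + 1), (-1 : ℝ) ^ m *
      (powCoeff n ((m + 1) * k) (3 * (m + 1)) -
        powCoeff n ((m + 1) * k + 1) (3 * (m + 1))) := by
    have h1 := congrArg (coeff n) (realSeries_eq_sum k (n + 1))
    -- After n + 1 geometric steps the remainder is divisible by X^{n+1}, so it does not reach the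
    -- coefficient of X^n.
    have h2 : coeff n ((-1) ^ (n + 1) * (X ^ k * realSeries 0 ^ 3) ^ (n + 1) *
        realSeries (k + 2)) = 0 := by
      refine (X_pow_dvd_iff (n := n + 1)).1 ?_ n (Nat.lt_succ_self n)
      refine Dvd.dvd.mul_right (Dvd.dvd.mul_left (pow_dvd_pow_of_dvd ?_ _) _) _
      exact Dvd.dvd.mul_left (Dvd.dvd.pow (X_dvd_realSeries 0) three_ne_zero) _
    rw [map_add, h2, add_zero, coeff_realSeries, map_sum] at h1
    rw [h1]
    refine Finset.sum_congr rfl fun m _ => ?_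
    have h3 : ((-1 : ℝ⟦X⟧)) ^ m * ((1 - X) * (X ^ k * realSeries 0 ^ 3) ^ (m + 1)) =
        C ((-1 : ℝ) ^ m) * (X ^ ((m + 1) * k) * realSeries 0 ^ (3 * (m + 1)) -
          X ^ ((m + 1) * k + 1) * realSeries 0 ^ (3 * (m + 1))) := by
      rw [map_pow, map_neg, map_one]
      ring
    rw [h3, coeff_C_mul, map_sub]
    rfl
  rw [h]
  refine hasSum_sum_of_ne_finset_zero fun m hm => ?_
  rw [Finset.mem_range, not_lt] at hm
  rw [powCoeff_eq_zero (by omega), powCoeff_eq_zero (by omega)]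
  simp

/-! ### Explicit coefficients of powers of R_0 (ballot numbers). -/

theorem powCoeff_succ (n b : ℕ) :
    powCoeff (n + 1) 0 (b + 1) = powCoeff n 0 b + powCoeff (n + 1) 0 (b + 2) := by
  have h : realSeries 0 ^ (b + 1) = X * realSeries 0 ^ b + realSeries 0 ^ (b + 2) := by
    linear_combination realSeries 0 ^ b * realSeries_zero
  simp only [powCoeff, pow_zero, one_mul]
  conv_lhs => rw [h]
  rw [map_add, coeff_succ_X_mul]

theorem powCoeff_zero_zero (n : ℕ) : powCoeff n 0 0 = if n = 0 then 1 else 0 := by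
  simp [powCoeff, coeff_one]

-- The relation R^{b+1} = zR^b + R^{b+2} is a Pascal-type recurrence. Indexed by the excess j of the
-- degree over the exponent, the term from R^{b+2} has smaller j and the one from zR^b has the same
-- j and smaller b, so a double induction replaces Lagrange inversion.
open Nat in
theorem powCoeff_mul_factorial (j b : ℕ) :
    powCoeff (b + 1 + j) 0 (b + 1) * (j ! * (j + b + 1)! : ℕ) = ((b + 1) * (2 * j + b)! : ℕ) := by
  induction j generalizing b with
  | zero =>
    have h : ∀ b, powCoeff b 0 b = 1 := by
      intro b
      induction b with
      | zero => simp [powCoeff_zero_zero]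
      | succ b ih => rw [powCoeff_succ, ih, powCoeff_eq_zero (by omega), add_zero]
    rw [add_zero, h]
    simp [Nat.factorial_succ]
  | succ j ihj =>
    induction b with
    | zero =>
      have h := ihj 1
      have e : powCoeff (0 + 1 + (j + 1)) 0 (0 + 1) = powCoeff (1 + 1 + j) 0 (1 + 1) := by
        rw [show 0 + 1 + (j + 1) = (j + 1) + 1 by ring, powCoeff_succ, powCoeff_zero_zero,
          if_neg (Nat.succ_ne_zero j), zero_add, show 1 + 1 + j = j + 1 + 1 by ring]
      rw [e]
      rw [show 2 * (j + 1) + 0 = (2 * j + 1) + 1 by ring, Nat.factorial_succ (2 * j + 1),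
        Nat.factorial_succ j, show j + 1 + 0 + 1 = j + 1 + 1 by ring]
      push_cast at h ⊢
      linear_combination (j + 1 : ℝ) * h
    | succ b ihb =>
      have h := ihj (b + 2)
      have e : powCoeff (b + 1 + 1 + (j + 1)) 0 (b + 1 + 1) =
          powCoeff (b + 1 + (j + 1)) 0 (b + 1) + powCoeff (b + 2 + 1 + j) 0 (b + 2 + 1) := by
        rw [show b + 1 + 1 + (j + 1) = (b + 1 + (j + 1)) + 1 by ring, powCoeff_succ,
          show b + 2 + 1 + j = (b + 1 + (j + 1)) + 1 by ring]
      rw [e]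
      rw [show 2 * (j + 1) + (b + 1) = (2 * j + b + 2) + 1 by ring,
        Nat.factorial_succ (2 * j + b + 2),
        show j + 1 + (b + 1) + 1 = (j + b + 2) + 1 by ring, Nat.factorial_succ (j + b + 2)]
      rw [show 2 * (j + 1) + b = 2 * j + b + 2 by ring, show j + 1 + b + 1 = j + b + 2 by ring]
        at ihb
      rw [show 2 * j + (b + 2) = 2 * j + b + 2 by ring,
        show j + (b + 2) + 1 = (j + b + 2) + 1 by ring, Nat.factorial_succ (j + b + 2)] at h
      rw [Nat.factorial_succ j] at ihb ⊢
      push_cast at h ihb ⊢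
      linear_combination (j + b + 3 : ℝ) * ihb + (j + 1 : ℝ) * h

open Nat in
theorem powCoeff_pos {n : ℕ} (hn : 1 ≤ n) : 0 < powCoeff n 0 1 := by
  obtain ⟨j, rfl⟩ := Nat.exists_eq_add_of_le hn
  have h := powCoeff_mul_factorial j 0
  have h1 : (0 : ℝ) < (j ! * (j + 0 + 1)! : ℕ) := by
    exact_mod_cast Nat.mul_pos (Nat.factorial_pos _) (Nat.factorial_pos _)
  have h2 : (0 : ℝ) < ((0 + 1) * (2 * j + 0)! : ℕ) := by
    exact_mod_cast Nat.mul_pos (Nat.succ_pos _) (Nat.factorial_pos _)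
  rw [← h] at h2
  simpa using pos_of_mul_pos_left h2 h1.le

open Nat in
theorem powCoeff_succ_right_mul {n b : ℕ} (h : b + 2 ≤ n) :
    powCoeff n 0 (b + 2) * ((b + 1) * (2 * n - b - 2)) =
      powCoeff n 0 (b + 1) * ((b + 2) * (n - b - 1)) := by
  obtain ⟨j, rfl⟩ := Nat.exists_eq_add_of_le h
  have h1 := powCoeff_mul_factorial j (b + 1)
  have h2 := powCoeff_mul_factorial (j + 1) b
  rw [show b + 1 + (j + 1) = b + 2 + j by ring, show j + 1 + b + 1 = j + b + 2 by ring,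
    Nat.factorial_succ j, show 2 * (j + 1) + b = (2 * j + b + 1) + 1 by ring,
    Nat.factorial_succ (2 * j + b + 1)] at h2
  rw [show b + 1 + 1 = b + 2 by ring, show j + (b + 1) + 1 = j + b + 2 by ring,
    show 2 * j + (b + 1) = 2 * j + b + 1 by ring] at h1
  have h3 : (j ! : ℝ) ≠ 0 := by exact_mod_cast Nat.factorial_ne_zero j
  have h4 : ((j + b + 2)! : ℝ) ≠ 0 := by exact_mod_cast Nat.factorial_ne_zero _
  push_cast at h1 h2 ⊢
  refine mul_right_cancel₀ (mul_ne_zero h3 h4) ?_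
  linear_combination (b + 1 : ℝ) * (2 * j + b + 2) * h1 - (b + 2 : ℝ) * h2

open Nat in
theorem powCoeff_succ_left_mul {n : ℕ} (hn : 1 ≤ n) :
    powCoeff (n + 1) 0 1 * (n + 1) = powCoeff n 0 1 * (4 * n - 2) := by
  obtain ⟨j, rfl⟩ := Nat.exists_eq_add_of_le hn
  have h1 := powCoeff_mul_factorial (j + 1) 0
  have h2 := powCoeff_mul_factorial j 0
  rw [show 2 * (j + 1) + 0 = (2 * j + 1) + 1 by ring, Nat.factorial_succ (2 * j + 1),
    Nat.factorial_succ (2 * j), Nat.factorial_succ j, show j + 1 + 0 + 1 = (j + 1) + 1 by ring,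
    Nat.factorial_succ (j + 1), zero_add, ← add_assoc] at h1
  rw [add_zero, add_zero, zero_add] at h2
  have h3 : (j ! : ℝ) ≠ 0 := by exact_mod_cast Nat.factorial_ne_zero j
  have h4 : ((j + 1)! : ℝ) ≠ 0 := by exact_mod_cast Nat.factorial_ne_zero _
  have h5 : (j + 1 : ℝ) ≠ 0 := by positivity
  push_cast at h1 h2 ⊢
  refine mul_right_cancel₀ (mul_ne_zero h5 (mul_ne_zero h3 h4)) ?_
  linear_combination h1 - (2 * j + 1 : ℝ) * (2 * j + 2) * h2

/-! ### Uniform second-order asymptotics of the coefficients. -/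

/-- Passing from b to b + 1 multiplies the normalised ratio by 1 - b/(2n - b - 2). Each factor lies
in [0, 1] and is about 1 - b/(2n), and these corrections add up to b(b-1)/(4n). -/
theorem ratio_powCoeff_bounds (n b : ℕ) (h : b + 1 ≤ n) :
    0 ≤ 2 ^ b * powCoeff n 0 (b + 1) / ((b + 1) * powCoeff n 0 1) ∧
    2 ^ b * powCoeff n 0 (b + 1) / ((b + 1) * powCoeff n 0 1) ≤ 1 ∧
    |2 ^ b * powCoeff n 0 (b + 1) / ((b + 1) * powCoeff n 0 1) - 1 + b * (b - 1) / (4 * n)| ≤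
      (b + 1) ^ 4 / n ^ 2 := by
  have hn : (1 : ℝ) ≤ n := by exact_mod_cast (by omega : 1 ≤ n)
  have hc := powCoeff_pos (n := n) (by omega)
  induction b with
  | zero =>
    simp only [pow_zero, zero_add, Nat.cast_zero, one_mul, zero_mul, zero_div, add_zero]
    rw [div_self hc.ne']
    simp
  | succ b ih =>
    obtain ⟨ih1, ih2, ih3⟩ := ih (by omega)
    have hr := powCoeff_succ_right_mul (n := n) (b := b) (by omega)
    have hbn : (b : ℝ) + 2 ≤ n := by exact_mod_cast (by omega : b + 2 ≤ n)
    set g : ℝ := 2 ^ b * powCoeff n 0 (b + 1) / ((b + 1) * powCoeff n 0 1) with hg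
    have hb : (0 : ℝ) ≤ b := Nat.cast_nonneg b
    have hb' : (0 : ℝ) ≤ b * (b - 1) := by
      rcases Nat.eq_zero_or_pos b with rfl | h0
      · simp
      · have : (1 : ℝ) ≤ b := by exact_mod_cast h0
        nlinarith
    have hd : (n : ℝ) ≤ 2 * n - b - 2 := by linarith
    have hd0 : (0 : ℝ) < 2 * n - b - 2 := by linarith
    set x : ℝ := b / (2 * n - b - 2) with hx
    have hx0 : 0 ≤ x := by positivity
    have hxn : x ≤ b / n := by rw [hx]; gcongr
    have hx1 : x ≤ 1 := by rw [hx, div_le_one hd0]; linarith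
    have hstep : 2 ^ (b + 1) * powCoeff n 0 (b + 1 + 1) /
        (((b + 1 : ℕ) + 1) * powCoeff n 0 1) = g * (1 - x) := by
      rw [hg, hx]
      push_cast
      field_simp
      rw [pow_succ]
      linear_combination 2 * (2 : ℝ) ^ b * hr
    rw [hstep]
    refine ⟨mul_nonneg ih1 (by linarith), by nlinarith, ?_⟩
    have h1 : x - b / (2 * n) = b * (b + 2) / (2 * n * (2 * n - b - 2)) := by
      rw [hx]; field_simp; ring
    have h2 : 0 ≤ x - b / (2 * n) := by rw [h1]; positivity
    have h3 : x - b / (2 * n) ≤ b * (b + 2) / (2 * n * n) := by rw [h1]; gcongr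
    have h4 : 0 ≤ x * (b * (b - 1) / (4 * n)) := by positivity
    have h5 : x * (b * (b - 1) / (4 * n)) ≤ b / n * (b * (b - 1) / (4 * n)) := by gcongr
    have h6 : g * (1 - x) - 1 + ((b + 1 : ℕ) : ℝ) * ((b + 1 : ℕ) - 1) / (4 * n) =
        (g - 1 + b * (b - 1) / (4 * n)) * (1 - x) + x * (b * (b - 1) / (4 * n)) -
          (x - b / (2 * n)) := by
      push_cast
      field_simp
      ring
    have h7 : |(g - 1 + b * (b - 1) / (4 * n)) * (1 - x)| ≤ (b + 1) ^ 4 / n ^ 2 := by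
      rw [abs_mul, abs_of_nonneg (by linarith : 0 ≤ 1 - x)]
      exact (mul_le_of_le_one_right (abs_nonneg _) (by linarith)).trans ih3
    have h8 : ((b + 1 : ℝ)) ^ 4 / n ^ 2 + b / n * (b * (b - 1) / (4 * n)) +
        b * (b + 2) / (2 * n * n) ≤ ((b + 1 : ℕ) + 1 : ℝ) ^ 4 / n ^ 2 := by
      have e : ((b + 1 : ℕ) + 1 : ℝ) ^ 4 / n ^ 2 - (((b + 1 : ℝ)) ^ 4 / n ^ 2 +
          b / n * (b * (b - 1) / (4 * n)) + b * (b + 2) / (2 * n * n)) =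
          (15 * b ^ 3 / 4 + 71 * b ^ 2 / 4 + 27 * b + 15) / n ^ 2 := by
        push_cast
        field_simp
        ring
      have : 0 ≤ (15 * (b : ℝ) ^ 3 / 4 + 71 * b ^ 2 / 4 + 27 * b + 15) / n ^ 2 := by positivity
      linarith
    rw [h6, abs_le]
    rw [abs_le] at h7
    constructor <;> linarith [h7.1, h7.2]

theorem four_mul_powCoeff {n : ℕ} (hn : 1 ≤ n) :
    4 * powCoeff n 0 1 = powCoeff (n + 1) 0 1 * ((n + 1) / (n - 1 / 2)) := by
  have h := powCoeff_succ_left_mul hn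
  have h1 : (1 : ℝ) ≤ n := by exact_mod_cast hn
  have h2 : (n - 1 / 2 : ℝ) ≠ 0 := by linarith
  rw [mul_div_assoc', eq_div_iff h2, h]
  ring

/-- The quotient is a product of s factors 4c_m/c_{m+1} = 1 + (3/2)/(m - 1/2), each at least 1 +
(3/2)/n. The condition 2s ≤ n keeps every m comparable to n. -/
theorem shift_powCoeff_bounds (n s : ℕ) (hn : 1 ≤ n) (h : 2 * s ≤ n) :
    1 + 3 * s / (2 * n) ≤ 4 ^ s * powCoeff (n - s) 0 1 / powCoeff n 0 1 ∧
    4 ^ s * powCoeff (n - s) 0 1 / powCoeff n 0 1 ≤ 1 + 3 * s / (2 * n) + 9 * s ^ 4 / n ^ 2 := by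
  have hn1 : (1 : ℝ) ≤ n := by exact_mod_cast hn
  have hc := powCoeff_pos hn
  induction s with
  | zero =>
    simp only [pow_zero, one_mul, Nat.sub_zero, div_self hc.ne']
    simp
  | succ s ih =>
    obtain ⟨ih1, ih2⟩ := ih (by omega)
    obtain ⟨m, rfl⟩ : ∃ m, n = m + s + 1 := ⟨n - s - 1, by omega⟩
    have hm := four_mul_powCoeff (n := m) (by omega)
    have hs1 : (s : ℝ) + 1 ≤ m := by exact_mod_cast (by omega : s + 1 ≤ m)
    have hs0 : (0 : ℝ) ≤ s := Nat.cast_nonneg s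
    rw [show m + s + 1 - s = m + 1 by omega] at ih1 ih2
    rw [show m + s + 1 - (s + 1) = m by omega]
    set c := powCoeff (m + s + 1) 0 1
    set H : ℝ := 4 ^ s * powCoeff (m + 1) 0 1 / c with hH
    have hd : (0 : ℝ) < m - 1 / 2 := by linarith
    have hd' : (2 * m - 1 : ℝ) ≠ 0 := by linarith
    have e : (4 : ℝ) ^ (s + 1) * powCoeff m 0 1 / c = H + H * ((3 / 2) / (m - 1 / 2)) := by
      have e' : (m + 1 : ℝ) / (m - 1 / 2) = 1 + 3 / 2 / (m - 1 / 2) := by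
        rw [eq_comm, ← sub_eq_zero]
        field_simp
        ring
      rw [hH, pow_succ, mul_assoc, hm, e']
      ring
    rw [e]
    set t : ℝ := ((m + s + 1 : ℕ) : ℝ) with ht
    have ht' : t = m + s + 1 := by rw [ht]; push_cast; ring
    have htpos : 0 < t := by linarith
    set δ : ℝ := (3 / 2) / (m - 1 / 2) with hδ
    have hδ1 : 3 / 2 / t ≤ δ := by
      rw [hδ]
      gcongr
      linarith
    have hδ2 : δ - 3 / 2 / t = (3 / 2) * (s + 3 / 2) / (t * (m - 1 / 2)) := by
      rw [hδ, ht']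
      have : (m + s + 1 : ℝ) ≠ 0 := by positivity
      field_simp
      ring
    have hmt : t / 4 ≤ m - 1 / 2 := by linarith
    have hδ3 : δ - 3 / 2 / t ≤ (3 / 2) * (s + 3 / 2) / (t * (t / 4)) := by
      rw [hδ2]
      gcongr
    have hδ4 : δ ≤ (3 / 2) / (t / 4) := by
      rw [hδ]
      gcongr
    have hδ0 : 0 ≤ δ := le_trans (by positivity) hδ1
    have hst : s / t ≤ 1 / 2 := by
      rw [div_le_iff₀ htpos]
      linarith
    push_cast
    have hH1 : 1 ≤ H := le_trans (le_add_of_nonneg_right (by positivity)) ih1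
    constructor
    · have e1 : 1 + 3 * ((s : ℝ) + 1) / (2 * t) = 1 + 3 * s / (2 * t) + 3 / 2 / t := by
        field_simp
        ring
      rw [e1]
      nlinarith
    · have h1 : H * δ ≤ δ + (3 * s / (2 * t) + 9 * s ^ 4 / t ^ 2) * ((3 / 2) / (t / 4)) := by
        have : (H - 1) * δ ≤ (3 * s / (2 * t) + 9 * s ^ 4 / t ^ 2) * ((3 / 2) / (t / 4)) := by
          gcongr
          linarith
        linarith
      have h2 : 9 * s ^ 4 / t ^ 2 * ((3 / 2) / (t / 4)) ≤ 27 * s ^ 3 / t ^ 2 := by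
        have e2 : 9 * s ^ 4 / t ^ 2 * ((3 / 2) / (t / 4)) = 54 * s ^ 3 / t ^ 2 * (s / t) := by
          field_simp
          ring
        rw [e2]
        calc 54 * (s : ℝ) ^ 3 / t ^ 2 * (s / t) ≤ 54 * (s : ℝ) ^ 3 / t ^ 2 * (1 / 2) := by gcongr
          _ = _ := by ring
      have e3 : 1 + 3 * ((s : ℝ) + 1) / (2 * t) + 9 * (s + 1) ^ 4 / t ^ 2 -
          (1 + 3 * s / (2 * t) + 9 * s ^ 4 / t ^ 2 + 3 / 2 / t +
            (3 / 2) * (s + 3 / 2) / (t * (t / 4)) + 3 * s / (2 * t) * ((3 / 2) / (t / 4)) +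
            27 * s ^ 3 / t ^ 2) = (9 * s ^ 3 + 54 * s ^ 2 + 21 * s) / t ^ 2 := by
        field_simp
        ring
      have h3 : 0 ≤ (9 * (s : ℝ) ^ 3 + 54 * s ^ 2 + 21 * s) / t ^ 2 := by positivity
      linarith

/-- The sequence c_n n^2 / 4^n is nondecreasing. This crude bound serves where s is not small
compared with n. -/
theorem shift_powCoeff_le (n s : ℕ) (hn : 1 ≤ n) :
    4 ^ s * (powCoeff n 0 1 * n ^ 2) ≤ powCoeff (n + s) 0 1 * ((n + s : ℕ) : ℝ) ^ 2 := by
  induction s with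
  | zero => simp
  | succ s ih =>
    have h := powCoeff_succ_left_mul (n := n + s) (by omega)
    have hc := powCoeff_pos (n := n + s) (by omega)
    have h1 : (1 : ℝ) ≤ (n + s : ℕ) := by exact_mod_cast (by omega : 1 ≤ n + s)
    rw [← add_assoc, pow_succ, mul_comm _ (4 : ℝ), mul_assoc, Nat.cast_succ (n + s),
      pow_two ((n + s : ℕ) + 1 : ℝ), ← mul_assoc (powCoeff _ 0 1), h]
    generalize ((n + s : ℕ) : ℝ) = t at *
    have : powCoeff (n + s) 0 1 * (4 * t ^ 2) ≤
        powCoeff (n + s) 0 1 * ((4 * t - 2) * (t + 1)) :=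
      mul_le_mul_of_nonneg_left (by nlinarith) hc.le
    linarith

/-- With L = b + 1 + s, the two preceding expansions are multiplied when 2L ≤ n. The statement has
no restriction on s and b, so it can be summed over every term of the geometric expansion. -/
theorem powCoeff_asymptotics (n s b : ℕ) (hn : 1 ≤ n) :
    |4 ^ s * 2 ^ b * powCoeff n s (b + 1) / ((b + 1) * powCoeff n 0 1) - 1 +
        b * (b - 1) / (4 * n) - 3 * s / (2 * n)| ≤ 40 * (b + 1 + s) ^ 4 / n ^ 2 := by
  have hn1 : (1 : ℝ) ≤ n := by exact_mod_cast hn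
  have hc := powCoeff_pos hn
  have hs0 : (0 : ℝ) ≤ s := Nat.cast_nonneg s
  have hb0 : (0 : ℝ) ≤ b := Nat.cast_nonneg b
  have hb' : (0 : ℝ) ≤ b * (b - 1) := by
    rcases Nat.eq_zero_or_pos b with rfl | h0
    · simp
    · have : (1 : ℝ) ≤ b := by exact_mod_cast h0
      nlinarith
  set q : ℝ := 4 ^ s * 2 ^ b * powCoeff n s (b + 1) / ((b + 1) * powCoeff n 0 1) with hq
  have hfac : s + b + 1 ≤ n →
      q = 2 ^ b * powCoeff (n - s) 0 (b + 1) / ((b + 1) * powCoeff (n - s) 0 1) *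
        (4 ^ s * powCoeff (n - s) 0 1 / powCoeff n 0 1) := by
    intro h
    have hc' := powCoeff_pos (n := n - s) (by omega)
    have e : powCoeff n s (b + 1) = powCoeff (n - s) 0 (b + 1) := by
      conv_lhs => rw [← Nat.sub_add_cancel (show s ≤ n by omega)]
      exact powCoeff_add _ _ _
    rw [hq, e]
    field_simp
  set L : ℝ := b + 1 + s with hL
  have hL1 : 1 ≤ L := by linarith
  have hβ : b * (b - 1) / 4 ≤ L ^ 2 := by nlinarith
  have hα : 3 * s / 2 ≤ 2 * L := by linarith
  have hα0 : (0 : ℝ) ≤ 3 * s / 2 := by positivity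
  have hβ0 : (0 : ℝ) ≤ b * (b - 1) / 4 := by positivity
  have e1 : (b : ℝ) * (b - 1) / (4 * n) = b * (b - 1) / 4 / n := by rw [div_div]
  have e2 : 3 * (s : ℝ) / (2 * n) = 3 * s / 2 / n := by rw [div_div]
  rcases le_or_gt (2 * (b + 1 + s)) n with hA | hB
  · have hLn : 2 * L ≤ n := by rw [hL]; exact_mod_cast hA
    obtain ⟨g0, g1, g2⟩ := ratio_powCoeff_bounds (n - s) b (by omega)
    obtain ⟨h1, h2⟩ := shift_powCoeff_bounds n s hn (by omega)
    rw [hfac (by omega)]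
    set g : ℝ := 2 ^ b * powCoeff (n - s) 0 (b + 1) / ((b + 1) * powCoeff (n - s) 0 1)
    set H : ℝ := 4 ^ s * powCoeff (n - s) 0 1 / powCoeff n 0 1
    have hN : ((n - s : ℕ) : ℝ) = n - s := by rw [Nat.cast_sub (by omega)]
    rw [hN] at g2
    set N : ℝ := n - s with hNdef
    have hN2 : (n : ℝ) / 2 ≤ N := by linarith
    have hNpos : 0 < N := by linarith
    rw [e1, e2]
    rw [show (b : ℝ) * (b - 1) / (4 * N) = b * (b - 1) / 4 / N by rw [div_div]] at g2
    rw [e2] at h1 h2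
    set β : ℝ := b * (b - 1) / 4
    set α : ℝ := 3 * s / 2
    have k1 : |g * (H - 1 - α / n)| ≤ 9 * L ^ 4 / n ^ 2 := by
      rw [abs_mul, abs_of_nonneg g0]
      refine (mul_le_of_le_one_left (abs_nonneg _) g1).trans ?_
      rw [abs_of_nonneg (by linarith)]
      have : 9 * (s : ℝ) ^ 4 / n ^ 2 ≤ 9 * L ^ 4 / n ^ 2 := by
        gcongr
        linarith
      linarith
    have k2 : |g - 1 + β / N| ≤ 4 * L ^ 4 / n ^ 2 := by
      refine g2.trans ?_
      calc ((b : ℝ) + 1) ^ 4 / N ^ 2 ≤ L ^ 4 / (n / 2) ^ 2 := by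
            gcongr
            linarith
        _ = _ := by field_simp; norm_num
    have k3 : 0 ≤ β / N - β / n ∧ β / N - β / n ≤ 2 * L ^ 3 / n ^ 2 := by
      have e : β / N - β / n = β * s / (n * N) := by
        rw [hNdef] at hNpos ⊢
        field_simp
        ring
      rw [e]
      refine ⟨by positivity, ?_⟩
      calc β * s / (n * N) ≤ L ^ 2 * L / (n * (n / 2)) := by
            gcongr
            linarith
        _ = _ := by field_simp
    have k4 : |α / n * (g - 1)| ≤ 8 * L ^ 4 / n ^ 2 := by
      have k5 : |g - 1| ≤ 4 * L ^ 3 / n := by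
        have k6 : β / N ≤ 2 * L ^ 2 / n := by
          calc β / N ≤ L ^ 2 / (n / 2) := by gcongr
            _ = _ := by field_simp
        have k7 : 4 * L ^ 4 / n ^ 2 ≤ 2 * L ^ 3 / n := by
          rw [div_le_div_iff₀ (by positivity) (by positivity)]
          have : 2 * L ^ 3 * n * (2 * L) ≤ 2 * L ^ 3 * n * n := by gcongr
          linarith
        have k8 : 2 * L ^ 2 / n ≤ 2 * L ^ 3 / n := by
          gcongr
          · norm_num
        have k9 : 0 ≤ β / N := by positivity
        have k10 : 4 * L ^ 3 / n = 2 * L ^ 3 / n + 2 * L ^ 3 / n := by ring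
        rw [abs_le] at k2 ⊢
        constructor <;> linarith [k2.1, k2.2]
      rw [abs_mul, abs_of_nonneg (by positivity)]
      calc α / n * |g - 1| ≤ 2 * L / n * (4 * L ^ 3 / n) := by gcongr
        _ = _ := by ring
    have k11 : 2 * L ^ 3 / n ^ 2 ≤ 2 * L ^ 4 / n ^ 2 := by
      gcongr
      · norm_num
    have e : g * H - 1 + β / n - α / n = g * (H - 1 - α / n) + α / n * (g - 1) +
        (g - 1 + β / N) - (β / N - β / n) := by ring
    have k12 : 0 ≤ L ^ 4 / n ^ 2 := by positivity
    have e9 : 9 * L ^ 4 / n ^ 2 = 9 * (L ^ 4 / n ^ 2) := by ring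
    have e4 : 4 * L ^ 4 / n ^ 2 = 4 * (L ^ 4 / n ^ 2) := by ring
    have e8 : 8 * L ^ 4 / n ^ 2 = 8 * (L ^ 4 / n ^ 2) := by ring
    have e5 : 2 * L ^ 4 / n ^ 2 = 2 * (L ^ 4 / n ^ 2) := by ring
    have e40 : 40 * L ^ 4 / n ^ 2 = 40 * (L ^ 4 / n ^ 2) := by ring
    rw [e]
    rw [abs_le] at k1 k2 k4 ⊢
    obtain ⟨k3a, k3b⟩ := k3
    constructor <;> linarith [k1.1, k1.2, k2.1, k2.2, k4.1, k4.2]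
  -- Here n < 2L makes the error term large: all quantities on the left are O(L^2), which n^2 ≤ 4L^2
  -- turns into the required bound.
  · have hLn : n < 2 * L := by rw [hL]; exact_mod_cast hB
    have hq2 : 0 ≤ q ∧ q ≤ n ^ 2 := by
      rcases lt_or_ge n (s + b + 1) with h | h
      · have : q = 0 := by rw [hq, powCoeff_eq_zero (by omega)]; simp
        rw [this]
        exact ⟨le_rfl, by positivity⟩
      · obtain ⟨g0, g1, -⟩ := ratio_powCoeff_bounds (n - s) b (by omega)
        rw [hfac h]
        have hc' := powCoeff_pos (n := n - s) (by omega)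
        have h1 := shift_powCoeff_le (n - s) s (by omega)
        rw [Nat.sub_add_cancel (by omega)] at h1
        refine ⟨mul_nonneg g0 (by positivity), ?_⟩
        refine (mul_le_of_le_one_left (by positivity) g1).trans ?_
        rw [div_le_iff₀ hc]
        have h2 : (1 : ℝ) ≤ (n - s : ℕ) := by exact_mod_cast (by omega : 1 ≤ n - s)
        have h3 : powCoeff (n - s) 0 1 * 1 ≤ powCoeff (n - s) 0 1 * ((n - s : ℕ) : ℝ) ^ 2 := by
          gcongr
          exact one_le_pow₀ h2
        have h4 : (4 : ℝ) ^ s * (powCoeff (n - s) 0 1 * 1) ≤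
          4 ^ s * (powCoeff (n - s) 0 1 * ((n - s : ℕ) : ℝ) ^ 2) := by gcongr
        linarith
    rw [e1, e2, le_div_iff₀ (by positivity)]
    set β : ℝ := b * (b - 1) / 4
    set α : ℝ := 3 * s / 2
    have hβn : β / n ≤ L ^ 2 := (div_le_self hβ0 hn1).trans hβ
    have hαn : α / n ≤ 2 * L ^ 2 := (div_le_self hα0 hn1).trans (by nlinarith)
    have hβn0 : 0 ≤ β / n := by positivity
    have hαn0 : 0 ≤ α / n := by positivity
    have hn2 : (n : ℝ) ^ 2 ≤ 4 * L ^ 2 := by nlinarith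
    have hL2 : 1 ≤ L ^ 2 := one_le_pow₀ hL1
    have habs : |q - 1 + β / n - α / n| ≤ 10 * L ^ 2 := by
      rw [abs_le]
      constructor <;> linarith [hq2.1, hq2.2]
    calc |q - 1 + β / n - α / n| * (n : ℝ) ^ 2 ≤ 10 * L ^ 2 * (4 * L ^ 2) := by gcongr
      _ = 40 * L ^ 4 := by ring

/-! ### Summing the main terms and the errors. -/

theorem hasSum_main_terms (k : ℕ) (n : ℝ) (hn : n ≠ 0) :
    HasSum (fun m : ℕ => (-1 : ℝ) ^ m * (1 / (8 * 4 ^ k)) ^ (m + 1) * (6 * (m + 1)) *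
        ((1 - (3 * m + 2) * (3 * m + 1) / (4 * n) + 3 * ((m + 1) * k) / (2 * n)) -
          (1 - (3 * m + 2) * (3 * m + 1) / (4 * n) + 3 * ((m + 1) * k + 1) / (2 * n)) / 4))
      (9 * (4 : ℝ) ^ (k + 2) / ((4 : ℝ) ^ (k + 2) + 2) ^ 2 +
        9 * (4 : ℝ) ^ (k + 2) *
            ((3 * ((k + 2 : ℕ) : ℝ) - 8) * (4 : ℝ) ^ (2 * (k + 2)) + 28 * (4 : ℝ) ^ (k + 2) -
              (12 * ((k + 2 : ℕ) : ℝ) + 20)) /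
          (2 * ((4 : ℝ) ^ (k + 2) + 2) ^ 4) * (1 / n)) := by
  have ha1 : (1 : ℝ) ≤ 4 ^ k := one_le_pow₀ (by norm_num)
  have e4 : (4 : ℝ) ^ (k + 2) = 16 * 4 ^ k := by rw [pow_add]; ring
  have e42 : (4 : ℝ) ^ (2 * (k + 2)) = (16 * 4 ^ k) ^ 2 := by rw [mul_comm 2, pow_mul, e4]
  rw [e42, e4]
  generalize (4 : ℝ) ^ k = a at *
  have ha0 : 0 < a := by linarith
  have hy : ‖-(1 / (8 * a))‖ < 1 := by
    rw [norm_neg, Real.norm_of_nonneg (by positivity), div_lt_one (by positivity)]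
    linarith
  have s1 := hasSum_choose_mul_geometric_of_norm_lt_one 1 hy
  have s2 := hasSum_choose_mul_geometric_of_norm_lt_one 2 hy
  have s3 := hasSum_choose_mul_geometric_of_norm_lt_one 3 hy
  have hC2 : ∀ m : ℕ, ((m + 2).choose 2 : ℝ) = (m + 2) * (m + 1) / 2 := by
    intro m
    rw [Nat.cast_choose_two]
    push_cast
    ring
  have hC3 : ∀ m : ℕ, ((m + 3).choose 3 : ℝ) = (m + 3) * (m + 2) * (m + 1) / 6 := by
    intro m
    have h := Nat.add_one_mul_choose_eq (m + 2) 2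
    have h' : ((m + 2 : ℕ) + 1 : ℝ) * ((m + 2).choose 2 : ℝ) = ((m + 3).choose 3 : ℝ) * 3 := by
      exact_mod_cast h
    rw [hC2] at h'
    push_cast at h'
    linarith
  -- The summand is a geometric term times a cubic polynomial in m divisible by m + 1. The
  -- coefficients come from writing that polynomial in the basis C(m+1,1), C(m+2,2), C(m+3,3).
  have S := ((s1.mul_left (1 / (8 * a) * (9 / 2 - (27 * k / 4 + 99 / 4) / n))).add
    (s2.mul_left (1 / (8 * a) * (27 * k / 2 + 81) / n))).add
    (s3.mul_left (1 / (8 * a) * (-243 / 4) / n))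
  refine (congrArg₂ (HasSum · ·) (funext fun m => ?_) ?_).mpr S
  · rw [hC2, hC3, Nat.choose_one_right, pow_succ (1 / (8 * a)), neg_pow (1 / (8 * a))]
    push_cast
    field_simp
    ring
  · have h2 : (1 - -(1 / (8 * a)) : ℝ) = (8 * a + 1) / (8 * a) := by
      rw [sub_neg_eq_add, eq_div_iff (by positivity), add_mul,
        one_div_mul_cancel (by positivity), one_mul]
    have h3 : (16 * a + 2 : ℝ) = 2 * (8 * a + 1) := by ring
    have h4 : (8 * a + 1 : ℝ) ≠ 0 := by positivity
    rw [h2, h3]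
    push_cast
    field_simp
    ring

/-- Up to the factor (3/4)^4, the number (k+4)^4 (3/4)^k is a single term of a convergent series of
nonnegative terms, hence at most its sum. -/
theorem exists_bound_pow_mul_geometric :
    ∃ D : ℝ, 0 ≤ D ∧ ∀ k : ℕ, ((k : ℝ) + 4) ^ 4 / 4 ^ k ≤ D / 3 ^ k := by
  have h := summable_pow_mul_geometric_of_norm_lt_one (R := ℝ) 4 (r := 3 / 4) (by norm_num)
  refine ⟨(∑' n : ℕ, (n : ℝ) ^ 4 * (3 / 4) ^ n) / (3 / 4) ^ 4,
    div_nonneg (tsum_nonneg fun n => by positivity) (by positivity), fun k => ?_⟩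
  have h1 := h.le_tsum (k + 4) fun n _ => by positivity
  rw [div_div, le_div_iff₀ (by positivity)]
  refine le_trans (le_of_eq ?_) h1
  rw [pow_add, div_pow _ _ k]
  push_cast
  field_simp

theorem abs_sub_main_terms_le (n k : ℕ) (hn : 1 ≤ n) :
    |(numProtected n (k + 2) : ℝ) / numProtected n 0 -
      (9 * (4 : ℝ) ^ (k + 2) / ((4 : ℝ) ^ (k + 2) + 2) ^ 2 +
        9 * (4 : ℝ) ^ (k + 2) *
            ((3 * ((k + 2 : ℕ) : ℝ) - 8) * (4 : ℝ) ^ (2 * (k + 2)) + 28 * (4 : ℝ) ^ (k + 2) -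
              (12 * ((k + 2 : ℕ) : ℝ) + 20)) /
          (2 * ((4 : ℝ) ^ (k + 2) + 2) ^ 4) * (1 / (n : ℝ)))| ≤
      300 * (((k : ℝ) + 4) ^ 4 / 4 ^ k) / n ^ 2 *
        ∑' m : ℕ, ((m + 1 : ℕ) : ℝ) ^ 5 * (1 / 8) ^ (m + 1) := by
  have hn0 : (0 : ℝ) < n := by exact_mod_cast hn
  have hc : powCoeff n 0 1 = numProtected n 0 := by
    rw [powCoeff, pow_zero, one_mul, pow_one, coeff_realSeries]
  have hcpos := powCoeff_pos hn
  have h1 := ((hasSum_numProtected n k).div_const (numProtected n 0 : ℝ)).sub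
    (hasSum_main_terms k n hn0.ne')
  have hsum : Summable fun m : ℕ => ((m + 1 : ℕ) : ℝ) ^ 5 * (1 / 8 : ℝ) ^ (m + 1) :=
    (summable_nat_add_iff 1).2
      (summable_pow_mul_geometric_of_norm_lt_one (R := ℝ) 5 (r := 1 / 8) (by norm_num))
  rw [← h1.tsum_eq, ← Real.norm_eq_abs]
  refine tsum_of_norm_bounded (hsum.hasSum.mul_left _) fun m => ?_
  have hq1 := powCoeff_asymptotics n ((m + 1) * k) (3 * m + 2) hn
  have hq2 := powCoeff_asymptotics n ((m + 1) * k + 1) (3 * m + 2) hn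
  rw [← hc]
  rw [show 3 * m + 2 + 1 = 3 * (m + 1) by ring] at hq1 hq2
  have ha0 : (0 : ℝ) < 4 ^ k := by positivity
  -- With b = 3m + 2 and s = (m+1)k, the weight (b+1) 4^{-s} 2^{-b} equals 6(m+1) (8·4^k)^{-(m+1)}.
  -- The extra shift by one from the factor 1 - z costs a further 1/4.
  have hpow : (4 : ℝ) ^ ((m + 1) * k) * 2 ^ (3 * m + 2) * 2 * (1 / (8 * 4 ^ k)) ^ (m + 1) = 1 := by
    rw [mul_assoc, mul_assoc, ← mul_assoc _ (2 : ℝ) (_ ^ _), ← pow_succ,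
      show 3 * m + 2 + 1 = 3 * (m + 1) by ring, pow_mul (2 : ℝ), mul_comm (m + 1) k, pow_mul,
      ← mul_pow, ← mul_pow]
    convert one_pow (m + 1)
    field_simp
    norm_num
  have hpow' : (4 : ℝ) ^ ((m + 1) * k + 1) * 2 ^ (3 * m + 2) * 2 * (1 / (8 * 4 ^ k)) ^ (m + 1) = 4 := by
    rw [pow_succ]
    linear_combination 4 * hpow
  have hx0 : (0 : ℝ) ≤ (1 / (8 * 4 ^ k)) ^ (m + 1) := by positivity
  have hx1 : (1 / (8 * 4 ^ k) : ℝ) ^ (m + 1) ≤ 1 / 4 ^ k * (1 / 8) ^ (m + 1) := by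
    have e : (1 / (8 * 4 ^ k) : ℝ) = 1 / 4 ^ k * (1 / 8) := by field_simp
    rw [e, mul_pow]
    gcongr
    refine pow_le_of_le_one (by positivity) ?_ (Nat.succ_ne_zero m)
    rw [div_le_one ha0]
    exact one_le_pow₀ (by norm_num)
  push_cast at hq1 hq2 ⊢
  set p1 := powCoeff n ((m + 1) * k) (3 * (m + 1))
  set p2 := powCoeff n ((m + 1) * k + 1) (3 * (m + 1))
  set c := powCoeff n 0 1
  set x : ℝ := (1 / (8 * 4 ^ k)) ^ (m + 1)
  set q1 : ℝ := 4 ^ ((m + 1) * k) * 2 ^ (3 * m + 2) * p1 / ((3 * m + 2 + 1) * c) with hq1d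
  set q2 : ℝ := 4 ^ ((m + 1) * k + 1) * 2 ^ (3 * m + 2) * p2 / ((3 * m + 2 + 1) * c) with hq2d
  have e3 : (3 * m + 2 + 1 : ℝ) = 3 * (m + 1) := by ring
  have e1 : p1 / c = x * (6 * (m + 1)) * q1 := by
    have : x * (6 * (m + 1)) * q1 =
      (4 ^ ((m + 1) * k) * 2 ^ (3 * m + 2) * 2 * x) * (p1 / c) := by
      rw [hq1d, e3]
      field_simp
      ring
    rw [this, hpow, one_mul]
  have e2 : p2 / c = x * (6 * (m + 1)) * (q2 / 4) := by
    have : x * (6 * (m + 1)) * (q2 / 4) =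
      (4 ^ ((m + 1) * k + 1) * 2 ^ (3 * m + 2) * 2 * x) * (p2 / c) / 4 := by
      rw [hq2d, e3]
      field_simp
      ring
    rw [this, hpow']
    ring
  set A : ℝ := 1 - (3 * m + 2) * (3 * m + 1) / (4 * n) + 3 * ((m + 1) * k) / (2 * n) with hA
  set B : ℝ := 1 - (3 * m + 2) * (3 * m + 1) / (4 * n) + 3 * ((m + 1) * k + 1) / (2 * n) with hB
  have hmain : (-1 : ℝ) ^ m * (p1 - p2) / c - (-1) ^ m * x * (6 * (m + 1)) * (A - B / 4) =
      (-1) ^ m * (x * (6 * (m + 1)) * ((q1 - A) - (q2 - B) / 4)) := by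
    rw [mul_div_assoc, sub_div, e1, e2]
    ring
  have hL : (3 * m + 2 + 1 + ((m + 1) * k + 1) : ℝ) ≤ (m + 1) * (k + 4) := by
    have : (0 : ℝ) ≤ m := Nat.cast_nonneg m
    nlinarith
  have hE1 : |q1 - A| ≤ 40 * ((m + 1) * (k + 4)) ^ 4 / n ^ 2 := by
    have e : q1 - A = q1 - 1 + (3 * m + 2) * (3 * m + 2 - 1) / (4 * n) -
        3 * ((m + 1) * k) / (2 * n) := by rw [hA]; ring
    rw [e]
    refine hq1.trans ?_
    gcongr
    linarith
  have hE2 : |q2 - B| ≤ 40 * ((m + 1) * (k + 4)) ^ 4 / n ^ 2 := by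
    have e : q2 - B = q2 - 1 + (3 * m + 2) * (3 * m + 2 - 1) / (4 * n) -
        3 * ((m + 1) * k + 1) / (2 * n) := by rw [hB]; ring
    rw [e]
    refine hq2.trans ?_
    gcongr
  have hE : |(q1 - A) - (q2 - B) / 4| ≤ 50 * ((m + 1) * (k + 4)) ^ 4 / n ^ 2 := by
    have e : 50 * (((m : ℝ) + 1) * (k + 4)) ^ 4 / n ^ 2 =
      40 * ((m + 1) * (k + 4)) ^ 4 / n ^ 2 + 40 * ((m + 1) * (k + 4)) ^ 4 / n ^ 2 / 4 := by ring
    rw [e]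
    rw [abs_le] at hE1 hE2 ⊢
    constructor <;> linarith [hE1.1, hE1.2, hE2.1, hE2.2]
  rw [hmain, Real.norm_eq_abs, abs_mul, abs_pow, abs_neg, abs_one, one_pow, one_mul, abs_mul,
    abs_of_nonneg (by positivity : 0 ≤ x * (6 * (m + 1)))]
  calc x * (6 * (m + 1)) * |(q1 - A) - (q2 - B) / 4|
      ≤ (1 / 4 ^ k * (1 / 8) ^ (m + 1)) * (6 * (m + 1)) *
        (50 * ((m + 1) * (k + 4)) ^ 4 / n ^ 2) := by gcongr
    _ = _ := by
      field_simp
      ring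

/-! ### The uniform estimate, including k = 0 and k = 1. -/

theorem numProtected_one {n : ℕ} (hn : n ≠ 1) : (numProtected n 1 : ℝ) = numProtected n 0 := by
  have h : realSeries 0 = PowerSeries.X + realSeries 1 := by
    rw [realSeries_one, pow_two]
    exact realSeries_zero
  have h1 := congrArg (PowerSeries.coeff n) h
  rwa [map_add, PowerSeries.coeff_X, if_neg hn, zero_add, coeff_realSeries, coeff_realSeries,
    eq_comm] at h1

theorem numProtected_zero_pos {n : ℕ} (hn : 1 ≤ n) : (0 : ℝ) < numProtected n 0 := by
  have h := powCoeff_pos hn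
  rwa [powCoeff, pow_zero, one_mul, pow_one, coeff_realSeries] at h

theorem exists_bound_prob_isProtected :
    ∃ C : ℝ, ∀ n : ℕ, 1 ≤ n → ∀ k : ℕ,
      |(uniformTree n).real {t : PlaneTree | k ≤ t.protectionNumber} -
          (9 * (4 : ℝ) ^ k / ((4 : ℝ) ^ k + 2) ^ 2 +
            9 * (4 : ℝ) ^ k *
                ((3 * (k : ℝ) - 8) * (4 : ℝ) ^ (2 * k) + 28 * (4 : ℝ) ^ k - (12 * (k : ℝ) + 20)) /
              (2 * ((4 : ℝ) ^ k + 2) ^ 4) * (1 / (n : ℝ)))| ≤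
        C * ((k : ℝ) ^ 2 / ((3 : ℝ) ^ k * (n : ℝ) ^ (3 / 2 : ℝ))) := by
  obtain ⟨D, hD0, hD⟩ := exists_bound_pow_mul_geometric
  set S : ℝ := ∑' m : ℕ, ((m + 1 : ℕ) : ℝ) ^ 5 * (1 / 8 : ℝ) ^ (m + 1) with hS
  have hS0 : 0 ≤ S := tsum_nonneg fun m => by positivity
  -- The 3 pays for k = n = 1, where the bound is C/3. The 2700 is 300 · 9, the 9 coming from
  -- 3^{k+2} = 9 · 3^k.
  refine ⟨3 + 2700 * D * S, fun n hn k => ?_⟩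
  have hn1 : (1 : ℝ) ≤ n := by exact_mod_cast hn
  have hc := numProtected_zero_pos hn
  rw [uniformTree_real_le_protectionNumber]
  rcases k with _ | _ | k
  -- For k = 0 the error bound is 0, so the main terms must give exactly 1: the 1/n coefficient
  -- vanishes.
  · rw [div_self hc.ne']
    norm_num
  · have e : (9 * (4 : ℝ) ^ (0 + 1) / ((4 : ℝ) ^ (0 + 1) + 2) ^ 2 +
            9 * (4 : ℝ) ^ (0 + 1) *
                ((3 * ((0 + 1 : ℕ) : ℝ) - 8) * (4 : ℝ) ^ (2 * (0 + 1)) + 28 * (4 : ℝ) ^ (0 + 1) -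
                  (12 * ((0 + 1 : ℕ) : ℝ) + 20)) /
              (2 * ((4 : ℝ) ^ (0 + 1) + 2) ^ 4) * (1 / (n : ℝ))) = 1 := by
      norm_num
    rw [e]
    -- For k = 1 the main terms again equal 1. The probability is 1 as well, except possibly at n =
    -- 1, where it suffices that it lies in [0, 1].
    rcases eq_or_ne n 1 with rfl | h
    · have h1 : (numProtected 1 (0 + 1) : ℝ) / numProtected 1 0 ≤ 1 := by
        rw [div_le_one hc]
        exact_mod_cast numProtected_le_zero 1 1
      have h2 : 0 ≤ (numProtected 1 (0 + 1) : ℝ) / numProtected 1 0 := by positivity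
      have h3 : 0 ≤ D * S := by positivity
      rw [abs_le]
      norm_num at *
      constructor <;> linarith
    · rw [zero_add, numProtected_one h, div_self hc.ne', sub_self, abs_zero]
      positivity
  · refine (abs_sub_main_terms_le n k hn).trans ?_
    rw [← hS]
    have h1 : (n : ℝ) ^ (3 / 2 : ℝ) ≤ n ^ 2 := by
      rw [← Real.rpow_natCast]
      exact Real.rpow_le_rpow_of_exponent_le hn1 (by norm_num)
    have h0 : 0 < (n : ℝ) ^ (3 / 2 : ℝ) := by positivity
    have h2 : (1 : ℝ) ≤ ((k + 2 : ℕ) : ℝ) ^ 2 := by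
      refine one_le_pow₀ ?_
      push_cast
      linarith [Nat.cast_nonneg (α := ℝ) k]
    calc 300 * (((k : ℝ) + 4) ^ 4 / 4 ^ k) / n ^ 2 * S
        ≤ 300 * (D / 3 ^ k) / (n : ℝ) ^ (3 / 2 : ℝ) * S := by
          have hDk := hD k
          gcongr
      _ = 2700 * D * S * (1 / ((3 : ℝ) ^ (k + 2) * (n : ℝ) ^ (3 / 2 : ℝ))) := by
          rw [pow_add]
          field_simp
          ring
      _ ≤ (3 + 2700 * D * S) *
            (((k + 2 : ℕ) : ℝ) ^ 2 / ((3 : ℝ) ^ (k + 2) * (n : ℝ) ^ (3 / 2 : ℝ))) := by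
          gcongr
          linarith

end PlaneTree

theorem mainTheorem3 :
    (∃ C : ℝ, ∀ n : ℕ, 1 ≤ n → ∀ k : ℕ,
      |(PlaneTree.uniformTree n).real {t : PlaneTree | k ≤ t.protectionNumber} -
          (9 * (4 : ℝ) ^ k / ((4 : ℝ) ^ k + 2) ^ 2 +
            9 * (4 : ℝ) ^ k *
                ((3 * (k : ℝ) - 8) * (4 : ℝ) ^ (2 * k) + 28 * (4 : ℝ) ^ k - (12 * (k : ℝ) + 20)) /
              (2 * ((4 : ℝ) ^ k + 2) ^ 4) * (1 / (n : ℝ)))| ≤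
        C * ((k : ℝ) ^ 2 / ((3 : ℝ) ^ k * (n : ℝ) ^ (3 / 2 : ℝ)))) ∧
    (∀ z : ℂ, z ≠ 0 → ‖z‖ < 1 / 4 → ∀ R₀ : ℂ, R₀ = (1 - (1 - 4 * z) ^ (1 / 2 : ℂ)) / 2 →
      HasSum (fun n : ℕ => (PlaneTree.numProtected n 0 : ℂ) * z ^ n) R₀ ∧
      ∀ k : ℕ, 1 ≤ k →
        1 + z ^ ((k : ℤ) - 2) * R₀ ^ 3 ≠ 0 ∧
        HasSum (fun n : ℕ => (PlaneTree.numProtected n k : ℂ) * z ^ n)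
          ((1 - z) * z ^ ((k : ℤ) - 2) * R₀ ^ 3 / (1 + z ^ ((k : ℤ) - 2) * R₀ ^ 3))) := by
  refine ⟨PlaneTree.exists_bound_prob_isProtected, fun z hz0 hz R₀ hR₀ => ?_⟩
  rw [← PlaneTree.protectedGF_zero_eq hz] at hR₀
  subst hR₀
  refine ⟨PlaneTree.hasSum_protectedGF 0 hz.le, fun k hk => ?_⟩
  obtain ⟨k, rfl⟩ := Nat.exists_eq_succ_of_ne_zero (Nat.one_le_iff_ne_zero.1 hk)
  obtain ⟨h1, h2⟩ := PlaneTree.protectedGF_formula hz0 hz k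
  exact ⟨h1, h2 ▸ PlaneTree.hasSum_protectedGF (k + 1) hz.le⟩
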